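/- Let $p$ be a prime number. If $p \equiv 1, 65$ or $81 \pmod{112}$, then $p$ is representable (by integers $x, y$) by both or by neither of the quadratic forms $x^2+56y^2$ and $x^2+448y^2$. If $p \equiv 9, 25$ or $57 \pmod{112}$, then $p$ is representable by exactly one of these two forms. -/

import Mathlib

/-- The integer `m` is represented by the binary quadratic form `x² + n y²`, with `x`, `y`
integers. -/
def IsRepresentedBy (n m : ℤ) : Prop :=
  ∃ x y : ℤ, m = x ^ 2 + n * y ^ 2

/-! All six classes give p ≡ 1 mod 8 and p a nonzero square mod 7, which forces p = a² + 112c². Here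
c even is the same as a representation by x² + 448y². By `isRepresentedBy_fiftysix_iff`, x² + 56y²
represents p exactly when "c is odd" and "p ≡ 9 mod 16" agree. So the two forms go together when p ≡
1 mod 16 and exclude each other when p ≡ 9 mod 16. For the criterion, Thue's lemma shows that p is
x² + 56y² or 2x² + 7y². Equating either with a² + 112c² turns a product into a value of r² - 2s²,
whose odd divisors are ±1 mod 8; this links the parity of c to p mod 16, in opposite ways for the
two forms. -/

/-! ### Odd divisors of r² - 2s² -/

theorem sq_emod_eight_of_odd {x : ℤ} (h : x % 2 = 1) : x ^ 2 % 8 = 1 := by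
  have h' : x ^ 2 % 8 = (x % 8) ^ 2 % 8 := by rw [pow_two, pow_two, Int.mul_emod]
  have h1 : x % 8 = 1 ∨ x % 8 = 3 ∨ x % 8 = 5 ∨ x % 8 = 7 := by omega
  rw [h']
  rcases h1 with h | h | h | h <;> rw [h] <;> norm_num

/-- An odd integer `n` dividing a value `r² - 2s²` is `±1` modulo `8`, provided no prime divides
`n`, the cofactor, `r` and `s` simultaneously. -/
theorem emod_eight_of_mul_eq_sq_sub_two_mul_sq (N : ℕ) :
    ∀ n m r s : ℤ, n.natAbs = N → n % 2 = 1 → n * m = r ^ 2 - 2 * s ^ 2 →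
      (∀ q : ℕ, q.Prime → (q : ℤ) ∣ n → (q : ℤ) ∣ m → (q : ℤ) ∣ r → (q : ℤ) ∣ s → False) →
      n % 8 = 1 ∨ n % 8 = 7 := by
  induction N using Nat.strong_induction_on with
  | _ N ih =>
  intro n m r s hN hodd hmul hcop
  by_cases h1 : n.natAbs = 1
  · rcases Int.natAbs_eq n with h | h <;> rw [h1] at h <;> omega
  obtain ⟨q, hq, hqn'⟩ := Nat.exists_prime_and_dvd h1
  have hqn : (q : ℤ) ∣ n := Int.natCast_dvd.mpr hqn'
  have hqZ : Prime (q : ℤ) := Nat.prime_iff_prime_int.mp hq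
  have hq2 := hq.two_le
  have hn0 : n ≠ 0 := by omega
  -- If q divides r and s, then q² divides n and is removed, being 1 mod 8. Otherwise 2 is a square
  -- mod q, so q ≡ ±1 mod 8, and q moves into the cofactor.
  by_cases hrs : (q : ℤ) ∣ r ∧ (q : ℤ) ∣ s
  · obtain ⟨⟨r', rfl⟩, ⟨s', rfl⟩⟩ := hrs
    have hqm : ¬ (q : ℤ) ∣ m := fun h =>
      hcop q hq hqn h (dvd_mul_right _ _) (dvd_mul_right _ _)
    have hq2n : (q : ℤ) ^ 2 ∣ n := by
      have : IsCoprime ((q : ℤ) ^ 2) m := (hqZ.coprime_iff_not_dvd.mpr hqm).pow_left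
      exact this.dvd_of_dvd_mul_right ⟨r' ^ 2 - 2 * s' ^ 2, by rw [hmul]; ring⟩
    obtain ⟨n', rfl⟩ := hq2n
    have hq0 : (q : ℤ) ≠ 0 := hqZ.ne_zero
    have hn'0 : n' ≠ 0 := by rintro rfl; simp at hn0
    have hqodd : (q : ℤ) % 2 = 1 := by
      rcases Int.emod_two_eq_zero_or_one (q : ℤ) with h | h
      · rw [pow_two, Int.mul_emod, Int.mul_emod (q : ℤ), h] at hodd; simp at hodd
      · exact h
    have hsq : (q : ℤ) ^ 2 % 8 = 1 := sq_emod_eight_of_odd hqodd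
    have hn'odd : n' % 2 = 1 := by
      rcases Int.emod_two_eq_zero_or_one n' with h | h
      · rw [Int.mul_emod, h] at hodd; simp at hodd
      · exact h
    have hlt : n'.natAbs < N := by
      rw [← hN, Int.natAbs_mul, Int.natAbs_pow, Int.natAbs_natCast]
      have : 0 < n'.natAbs := Int.natAbs_pos.mpr hn'0
      exact lt_mul_of_one_lt_left this (Nat.one_lt_pow two_ne_zero hq.one_lt)
    have key := ih _ hlt n' m r' s' rfl hn'odd
      (mul_left_cancel₀ (pow_ne_zero 2 hq0) (by linear_combination hmul))
      fun l hl h1 h2 h3 h4 =>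
        hcop l hl (h1.mul_left _) h2 (h3.mul_left _) (h4.mul_left _)
    rw [Int.mul_emod, hsq]
    omega
  · obtain ⟨n', rfl⟩ := hqn
    have hn'0 : n' ≠ 0 := by rintro rfl; simp at hn0
    have hqodd : (q : ℤ) % 2 = 1 := by
      rcases Int.emod_two_eq_zero_or_one (q : ℤ) with h | h
      · rw [Int.mul_emod, h] at hodd; simp at hodd
      · exact h
    have hn'odd : n' % 2 = 1 := by
      rcases Int.emod_two_eq_zero_or_one n' with h | h
      · rw [Int.mul_emod, h] at hodd; simp at hodd
      · exact h
    have hlt : n'.natAbs < N := by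
      rw [← hN, Int.natAbs_mul, Int.natAbs_natCast]
      have : 0 < n'.natAbs := Int.natAbs_pos.mpr hn'0
      exact lt_mul_of_one_lt_left this hq.one_lt
    have key := ih _ hlt n' (q * m) r s rfl hn'odd (by linear_combination hmul)
      fun l hl h1 h2 h3 h4 => by
        rcases (Nat.prime_iff_prime_int.mp hl).dvd_or_dvd h2 with h | h
        · have := (Nat.prime_dvd_prime_iff_eq hl hq).mp (Int.natCast_dvd_natCast.mp h)
          subst this
          exact hrs ⟨h3, h4⟩
        · exact hcop l hl (h1.mul_left _) h h3 h4
    have : Fact q.Prime := ⟨hq⟩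
    have hq8 : q % 8 = 1 ∨ q % 8 = 7 := by
      refine (ZMod.exists_sq_eq_two_iff (by omega)).mp ?_
      have hz : (r : ZMod q) ^ 2 = 2 * (s : ZMod q) ^ 2 := by
        have h := congrArg (Int.cast : ℤ → ZMod q) hmul
        push_cast at h
        rw [ZMod.natCast_self] at h
        linear_combination -h
      have hs : (s : ZMod q) ≠ 0 := by
        intro hs
        rw [hs] at hz
        have hr : (r : ZMod q) = 0 := by simpa using hz
        exact hrs ⟨(ZMod.intCast_zmod_eq_zero_iff_dvd _ _).mp hr,
          (ZMod.intCast_zmod_eq_zero_iff_dvd _ _).mp hs⟩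
      exact ⟨r / s, by field_simp; exact hz.symm⟩
    have hq8' : (q : ℤ) % 8 = 1 ∨ (q : ℤ) % 8 = 7 := by omega
    rw [Int.mul_emod]
    rcases hq8' with h | h <;> rcases key with h' | h' <;> rw [h, h'] <;> norm_num

/-! ### Parity of c against p mod 16 -/

theorem not_sq_dvd_of_prime {p q : ℕ} (hp : p.Prime) (hq : q.Prime) {x y k : ℤ}
    (h : (p : ℤ) = x ^ 2 + k * y ^ 2) (hx : (q : ℤ) ∣ x) (hy : (q : ℤ) ∣ y) : False := by
  have hd : (q : ℤ) * q ∣ p := by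
    rw [h]
    obtain ⟨x', rfl⟩ := hx
    obtain ⟨y', rfl⟩ := hy
    exact ⟨x' ^ 2 + k * y' ^ 2, by ring⟩
  have hd' : q * q ∣ p := by exact_mod_cast hd
  exact (Nat.squarefree_iff_prime_squarefree.mp hp.prime.squarefree) q hq hd'

theorem sq_emod_sixteen_of_emod_eight (a : ℤ) :
    ((a % 8 = 1 ∨ a % 8 = 7) → a ^ 2 % 16 = 1) ∧ ((a % 8 = 3 ∨ a % 8 = 5) → a ^ 2 % 16 = 9) := by
  have h : a ^ 2 % 16 = (a % 16) ^ 2 % 16 := by rw [pow_two, pow_two, Int.mul_emod]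
  rw [h]
  have h1 : a % 16 = 1 ∨ a % 16 = 3 ∨ a % 16 = 5 ∨ a % 16 = 7 ∨ a % 16 = 9 ∨ a % 16 = 11 ∨
      a % 16 = 13 ∨ a % 16 = 15 ∨ a % 2 = 0 := by omega
  rcases h1 with h | h | h | h | h | h | h | h | h <;> (try rw [h]) <;> constructor <;> intro _ <;>
    omega

/-- Since 7(y - 4c)(y + 4c) = a² - 2x², y - 4c is ±1 mod 8. Hence y² mod 16 is 9 or 1 as c is odd or
even, and p ≡ 2 + 7y² mod 16. -/
theorem odd_iff_of_two_mul_sq_add_seven_mul_sq {p : ℕ} (hp : p.Prime) (hp8 : p % 8 = 1)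
    {x y a c : ℤ} (h1 : (p : ℤ) = 2 * x ^ 2 + 7 * y ^ 2) (h2 : (p : ℤ) = a ^ 2 + 112 * c ^ 2) :
    c % 2 = 1 ↔ p % 16 = 1 := by
  have hy : y % 2 = 1 := by
    rcases Int.emod_two_eq_zero_or_one y with h | h
    · have : 2 ∣ y ^ 2 := (Int.dvd_of_emod_eq_zero h).pow two_ne_zero
      omega
    · exact h
  have hy8 := sq_emod_eight_of_odd hy
  have hx : x % 2 = 1 := by
    rcases Int.emod_two_eq_zero_or_one x with h | h
    · obtain ⟨z, rfl⟩ := Int.dvd_of_emod_eq_zero h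
      rw [mul_pow] at h1
      omega
    · exact h
  have hx8 := sq_emod_eight_of_odd hx
  have key := emod_eight_of_mul_eq_sq_sub_two_mul_sq _ (y - 4 * c) (7 * (y + 4 * c)) a x rfl
    (by omega) (by linear_combination h2 - h1) fun q hq k1 k2 k3 k4 => by
      rcases eq_or_ne q 7 with rfl | hq7
      · have : (7 : ℤ) ∣ x := by exact_mod_cast k4
        obtain ⟨z, rfl⟩ := this
        have : (7 : ℤ) ∣ p := by rw [h1]; exact ⟨14 * z ^ 2 + y ^ 2, by ring⟩
        have : p = 7 := ((Nat.prime_dvd_prime_iff_eq hq hp).mp (by exact_mod_cast this)).symm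
        omega
      have hqZ : Prime (q : ℤ) := Nat.prime_iff_prime_int.mp hq
      have k5 : (q : ℤ) ∣ y + 4 * c := by
        rcases hqZ.dvd_or_dvd k2 with h | h
        · exact absurd ((Nat.prime_dvd_prime_iff_eq hq (by norm_num)).mp (by exact_mod_cast h)) hq7
        · exact h
      have k6 : (q : ℤ) ∣ 2 * y := by
        have := dvd_add k1 k5
        ring_nf at this ⊢
        exact this
      have k7 : (q : ℤ) ∣ y := by
        rcases hqZ.dvd_or_dvd k6 with h | h
        · have : q = 2 :=
            (Nat.prime_dvd_prime_iff_eq hq (by norm_num)).mp (by exact_mod_cast h)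
          subst this
          omega
        · exact h
      have hd : (q : ℤ) * q ∣ p := by
        rw [h1]
        obtain ⟨x', rfl⟩ := k4
        obtain ⟨y', rfl⟩ := k7
        exact ⟨2 * x' ^ 2 + 7 * y' ^ 2, by ring⟩
      exact (Nat.squarefree_iff_prime_squarefree.mp hp.prime.squarefree) q hq
        (by exact_mod_cast hd)
  have hy16 := sq_emod_sixteen_of_emod_eight y
  omega

theorem odd_iff_of_sq_add_fiftysix_mul_sq_aux {p : ℕ} (hp : p.Prime) {s t y c : ℤ}
    (h1 : (p : ℤ) = (s + 7 * t) ^ 2 + 56 * y ^ 2) (h2 : (p : ℤ) = (s - 7 * t) ^ 2 + 112 * c ^ 2)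
    (hst : (s + 7 * t) % 2 = 1) : c % 2 = 1 ↔ p % 16 = 9 := by
  have hmul : s * t = (2 * c) ^ 2 - 2 * y ^ 2 := by linarith
  have hcop : ∀ q : ℕ, q.Prime → (q : ℤ) ∣ s → (q : ℤ) ∣ t → (q : ℤ) ∣ y → False :=
    fun q hq k1 k2 k3 => not_sq_dvd_of_prime hp hq h1 (dvd_add k1 (k2.mul_left _)) k3
  have hcy : ∀ z : ℤ, z % 2 = 0 ∨ z ^ 2 % 8 = 1 := fun z => by
    rcases Int.emod_two_eq_zero_or_one z with h | h
    · exact Or.inl h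
    · exact Or.inr (sq_emod_eight_of_odd h)
  have hc2 : c % 2 = 0 → c ^ 2 % 4 = 0 := fun h => by
    obtain ⟨d, rfl⟩ := Int.dvd_of_emod_eq_zero h
    rw [mul_pow]; omega
  have hy2 : y % 2 = 0 → y ^ 2 % 4 = 0 := fun h => by
    obtain ⟨d, rfl⟩ := Int.dvd_of_emod_eq_zero h
    rw [mul_pow]; omega
  have ha16 := sq_emod_sixteen_of_emod_eight (s - 7 * t)
  -- One of s, t is 2k and the other is the odd o; either way s - 7t ≡ 2k + o mod 8, and p ≡ (s -
  -- 7t)² mod 16.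
  have core : ∀ k o : ℤ, o % 2 = 1 → k * o = 2 * c ^ 2 - y ^ 2 →
      (∀ q : ℕ, q.Prime → (q : ℤ) ∣ k → (q : ℤ) ∣ o → (q : ℤ) ∣ y → False) →
      ((c % 2 = 1 ↔ (2 * k + o) % 8 = 3 ∨ (2 * k + o) % 8 = 5) ∧
        ((2 * k + o) % 8 = 1 ∨ (2 * k + o) % 8 = 3 ∨ (2 * k + o) % 8 = 5 ∨
          (2 * k + o) % 8 = 7)) := by
    intro k o ho hk hq
    have h8 := emod_eight_of_mul_eq_sq_sub_two_mul_sq _ o (-k) y c rfl ho (by linear_combination -hk)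
      fun q hq' k1 k2 k3 _ => hq q hq' ((dvd_neg).mp k2) k1 k3
    rcases Int.emod_two_eq_zero_or_one k with hk2 | hk2
    · have hyev : y % 2 = 0 := by
        obtain ⟨l, rfl⟩ := Int.dvd_of_emod_eq_zero hk2
        have : 2 * (l * o) = 2 * c ^ 2 - y ^ 2 := by linear_combination hk
        rcases hcy y with h | h <;> omega
      have hy4 := hy2 hyev
      obtain ⟨l, rfl⟩ := Int.dvd_of_emod_eq_zero hk2
      have hlo : 2 * (l * o) = 2 * c ^ 2 - y ^ 2 := by linear_combination hk
      have hl : (l * o) % 2 = l % 2 := by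
        rw [Int.mul_emod, ho]; omega
      rcases hcy c with h | h
      · have := hc2 h
        omega
      · have : c % 2 = 1 := by
          rcases Int.emod_two_eq_zero_or_one c with h' | h'
          · have := hc2 h'; omega
          · exact h'
        omega
    · have hk8 := emod_eight_of_mul_eq_sq_sub_two_mul_sq _ k (-o) y c rfl hk2
        (by linear_combination -hk) fun q hq' k1 k2 k3 _ => hq q hq' k1 ((dvd_neg).mp k2) k3
      have hko : (k * o) % 8 = (k % 8) * (o % 8) % 8 := Int.mul_emod _ _ _
      have hc8 : c % 2 = 1 → c ^ 2 % 8 = 1 := fun h =>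
        sq_emod_eight_of_odd h
      have hyo : y ^ 2 % 8 = 1 := by
        rcases hcy y with h | h
        · have := hy2 h
          rcases h8 with h8 | h8 <;> rcases hk8 with hk8 | hk8 <;> rw [h8, hk8] at hko <;> omega
        · exact h
      rcases h8 with h8 | h8 <;> rcases hk8 with hk8 | hk8 <;> rw [h8, hk8] at hko <;> omega
  rcases Int.emod_two_eq_zero_or_one s with hs | hs
  · obtain ⟨k, rfl⟩ := Int.dvd_of_emod_eq_zero hs
    have := core k t (by omega) (by linarith) fun q hq k1 k2 k3 =>
      hcop q hq (k1.mul_left _) k2 k3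
    omega
  · have ht : t % 2 = 0 := by omega
    obtain ⟨k, rfl⟩ := Int.dvd_of_emod_eq_zero ht
    have := core k s hs (by linarith) fun q hq k1 k2 k3 =>
      hcop q hq k2 (k1.mul_left _) k3
    omega

theorem odd_iff_of_sq_add_fiftysix_mul_sq {p : ℕ} (hp : p.Prime) (hp8 : p % 8 = 1)
    {x y a c : ℤ} (h1 : (p : ℤ) = x ^ 2 + 56 * y ^ 2) (h2 : (p : ℤ) = a ^ 2 + 112 * c ^ 2) :
    c % 2 = 1 ↔ p % 16 = 9 := by
  have hodd : ∀ z : ℤ, z ^ 2 % 2 = 1 → z % 2 = 1 := fun z hz => by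
    rcases Int.emod_two_eq_zero_or_one z with h | h
    · have : 2 ∣ z ^ 2 := (Int.dvd_of_emod_eq_zero h).pow two_ne_zero
      omega
    · exact h
  have hx := hodd x (by omega)
  have ha := hodd a (by omega)
  have h7 : (7 : ℤ) ∣ (x - a) * (x + a) := ⟨8 * (2 * c ^ 2 - y ^ 2), by linear_combination h2 - h1⟩
  have p7 : Prime (7 : ℤ) := by norm_num
  rcases p7.dvd_or_dvd h7 with h | h
  -- Both x and a are odd, so 7 ∣ x - a gives 14 ∣ x - a.
  · obtain ⟨t, ht⟩ : ∃ t, x - a = 14 * t := ⟨(x - a) / 14, by omega⟩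
    obtain ⟨s, hs⟩ : ∃ s, x + a = 2 * s := ⟨(x + a) / 2, by omega⟩
    obtain rfl : x = s + 7 * t := by omega
    obtain rfl : a = s - 7 * t := by omega
    exact odd_iff_of_sq_add_fiftysix_mul_sq_aux hp h1 h2 hx
  · obtain ⟨t, ht⟩ : ∃ t, x + a = 14 * t := ⟨(x + a) / 14, by omega⟩
    obtain ⟨s, hs⟩ : ∃ s, x - a = 2 * s := ⟨(x - a) / 2, by omega⟩
    obtain rfl : x = s + 7 * t := by omega
    obtain rfl : a = -(s - 7 * t) := by omega
    exact odd_iff_of_sq_add_fiftysix_mul_sq_aux hp h1 (by rw [h2]; ring) hx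

/-! ### Existence of representations -/

/-- **Thue's lemma**: every residue `l` modulo a prime `p` is a quotient of two integers of
absolute value less than `√p`. -/
theorem exists_small_eq_mul {p : ℕ} (hp : p.Prime) (l : ZMod p) :
    ∃ x y : ℤ, (x ≠ 0 ∨ y ≠ 0) ∧ x ^ 2 < p ∧ y ^ 2 < p ∧ (x : ZMod p) = l * y := by
  have : Fact p.Prime := ⟨hp⟩
  set s := Nat.sqrt p with hs
  let f : Fin (s + 1) × Fin (s + 1) → ZMod p := fun u => (u.1 : ℕ) - l * (u.2 : ℕ)
  have hcard : Fintype.card (ZMod p) < Fintype.card (Fin (s + 1) × Fin (s + 1)) := by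
    rw [ZMod.card, Fintype.card_prod, Fintype.card_fin]
    exact Nat.lt_succ_sqrt p
  obtain ⟨⟨u1, u2⟩, ⟨v1, v2⟩, hne, hf⟩ := Fintype.exists_ne_map_eq_of_card_lt f hcard
  have hsq : s ^ 2 < p := by
    refine lt_of_le_of_ne (Nat.sqrt_le' p) fun h => ?_
    exact (Nat.Prime.prime hp).irreducible.not_isSquare ⟨s, by rw [← pow_two]; exact h.symm⟩
  have small : ∀ a b : Fin (s + 1), (((a : ℕ) : ℤ) - ((b : ℕ) : ℤ)) ^ 2 < (p : ℤ) := by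
    intro a b
    have ha := a.2
    have hb := b.2
    have h : (((a : ℕ) : ℤ) - ((b : ℕ) : ℤ)) ^ 2 ≤ (s : ℤ) ^ 2 :=
      sq_le_sq' (by omega) (by omega)
    exact lt_of_le_of_lt h (by exact_mod_cast hsq)
  refine ⟨(u1 : ℕ) - (v1 : ℕ), (u2 : ℕ) - (v2 : ℕ), ?_, small _ _, small _ _, ?_⟩
  · by_contra! h
    refine hne (Prod.ext (Fin.ext ?_) (Fin.ext ?_))
    · have := h.1
      simp only
      omega
    · have := h.2
      simp only
      omega
  · simp only [f] at hf
    push_cast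
    linear_combination hf

theorem isSquare_neg_seven {p : ℕ} [Fact p.Prime] (hp8 : p % 8 = 1)
    (hp7 : p % 7 = 1 ∨ p % 7 = 2 ∨ p % 7 = 4) : IsSquare (-7 : ZMod p) := by
  have : Fact (Nat.Prime 7) := ⟨by norm_num⟩
  have h1 : IsSquare (-1 : ZMod p) := ZMod.exists_sq_eq_neg_one_iff.mpr (by omega)
  have h2 : IsSquare ((7 : ℕ) : ZMod p) := by
    refine (ZMod.exists_sq_eq_prime_iff_of_mod_four_eq_one (by omega) (by norm_num)).mpr ?_
    rw [← ZMod.natCast_mod]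
    rcases hp7 with h | h | h <;> rw [h]
    · exact ⟨1, rfl⟩
    · exact ⟨3, rfl⟩
    · exact ⟨2, rfl⟩
  have := h1.mul h2
  push_cast at this
  simpa using this

theorem isSquare_two {p : ℕ} [Fact p.Prime] (hp8 : p % 8 = 1) : IsSquare (2 : ZMod p) :=
  (ZMod.exists_sq_eq_two_iff (by omega)).mpr (Or.inl hp8)

theorem sq_emod_seven (x : ℤ) :
    x ^ 2 % 7 = 0 ∧ x % 7 = 0 ∨ x ^ 2 % 7 = 1 ∨ x ^ 2 % 7 = 2 ∨ x ^ 2 % 7 = 4 := by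
  have h : x ^ 2 % 7 = (x % 7) ^ 2 % 7 := by rw [pow_two, pow_two, Int.mul_emod]
  rw [h]
  have h1 : x % 7 = 0 ∨ x % 7 = 1 ∨ x % 7 = 2 ∨ x % 7 = 3 ∨ x % 7 = 4 ∨ x % 7 = 5 ∨
      x % 7 = 6 := by omega
  rcases h1 with h | h | h | h | h | h | h <;> rw [h] <;> norm_num

theorem sq_emod_eight (x : ℤ) :
    (∃ z, x = 2 * z ∧ x ^ 2 = 4 * z ^ 2) ∨ x % 2 = 1 ∧ x ^ 2 % 8 = 1 := by
  rcases Int.emod_two_eq_zero_or_one x with h | h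
  · obtain ⟨z, rfl⟩ := Int.dvd_of_emod_eq_zero h
    exact Or.inl ⟨z, rfl, by ring⟩
  · exact Or.inr ⟨h, sq_emod_eight_of_odd h⟩

theorem exists_eq_sq_add_seven_mul_sq {p : ℕ} (hp : p.Prime) (hp8 : p % 8 = 1)
    (hp7 : p % 7 = 1 ∨ p % 7 = 2 ∨ p % 7 = 4) : ∃ a b : ℤ, (p : ℤ) = a ^ 2 + 7 * b ^ 2 := by
  have : Fact p.Prime := ⟨hp⟩
  obtain ⟨l, hl⟩ := isSquare_neg_seven hp8 hp7
  obtain ⟨x, y, hne, hx, hy, hxy⟩ := exists_small_eq_mul hp l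
  have hd : (p : ℤ) ∣ x ^ 2 + 7 * y ^ 2 := by
    rw [← ZMod.intCast_zmod_eq_zero_iff_dvd]
    push_cast
    rw [hxy]
    linear_combination -(y : ZMod p) ^ 2 * hl
  obtain ⟨m, hm⟩ := hd
  have hp0 : (0 : ℤ) < p := by exact_mod_cast hp.pos
  have hpos : 0 < x ^ 2 + 7 * y ^ 2 := by
    rcases hne with h | h <;> positivity
  have hm0 : 0 < m := by
    rw [hm] at hpos; exact (pos_iff_pos_of_mul_pos hpos).mp hp0
  have hm8 : m < 8 := by
    by_contra! h
    nlinarith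
  have hx7 := sq_emod_seven x
  -- The multipliers 3, 5, 6 are non-squares mod 7, unlike p; 2 fails mod 8; 4 and 7 reduce to 1.
  interval_cases m
  · exact ⟨x, y, by linarith⟩
  · exfalso
    rcases sq_emod_eight x with ⟨z, hz, hz'⟩ | hx2 <;>
      rcases sq_emod_eight y with ⟨w, hw, hw'⟩ | hy2 <;> omega
  · exfalso; omega
  · rcases sq_emod_eight x with ⟨z, hz, hz'⟩ | hx2 <;> rcases sq_emod_eight y with ⟨w, hw, hw'⟩ | hy2
    · exact ⟨z, w, by linarith⟩
    all_goals exfalso; omega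
  · exfalso; omega
  · exfalso; omega
  · obtain ⟨z, rfl⟩ : (7 : ℤ) ∣ x := by omega
    exact ⟨y, z, by linarith⟩

theorem exists_eq_sq_add_hundredtwelve_mul_sq {p : ℕ} (hp : p.Prime) (hp8 : p % 8 = 1)
    (hp7 : p % 7 = 1 ∨ p % 7 = 2 ∨ p % 7 = 4) :
    ∃ a c : ℤ, (p : ℤ) = a ^ 2 + 112 * c ^ 2 := by
  obtain ⟨a, b, h⟩ := exists_eq_sq_add_seven_mul_sq hp hp8 hp7
  rcases sq_emod_eight b with ⟨c, rfl, hc⟩ | hb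
  · rcases sq_emod_eight c with ⟨d, rfl, hd⟩ | hb
    · exact ⟨a, d, by linarith⟩
    · rcases sq_emod_eight a with ⟨w, hw, hw'⟩ | ha <;> omega
  · rcases sq_emod_eight a with ⟨w, hw, hw'⟩ | ha <;> omega

theorem exists_eq_sq_add_fourteen_mul_sq_or {p : ℕ} (hp : p.Prime) (hp8 : p % 8 = 1)
    (hp7 : p % 7 = 1 ∨ p % 7 = 2 ∨ p % 7 = 4) :
    (∃ x y : ℤ, (p : ℤ) = x ^ 2 + 14 * y ^ 2) ∨ ∃ x y : ℤ, (p : ℤ) = 2 * x ^ 2 + 7 * y ^ 2 := by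
  have : Fact p.Prime := ⟨hp⟩
  obtain ⟨k, hk⟩ := isSquare_neg_seven hp8 hp7
  obtain ⟨j, hj⟩ := isSquare_two (p := p) hp8
  have hj0 : j ≠ 0 := by
    rintro rfl
    have h2 : ((2 : ℕ) : ZMod p) = 0 := by push_cast; rw [hj]; ring
    rw [ZMod.natCast_eq_zero_iff] at h2
    have := Nat.le_of_dvd two_pos h2
    have := hp.two_le
    omega
  -- `k / j` is a square root of -7/2 mod p.
  obtain ⟨x, y, hne, hx, hy, hxy⟩ := exists_small_eq_mul hp (k / j)
  have hd : (p : ℤ) ∣ 2 * x ^ 2 + 7 * y ^ 2 := by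
    rw [← ZMod.intCast_zmod_eq_zero_iff_dvd]
    push_cast
    have h : (x : ZMod p) * j = k * y := by rw [hxy]; field_simp
    linear_combination (x : ZMod p) ^ 2 * hj - (y : ZMod p) ^ 2 * hk + (x * j + k * y) * h
  obtain ⟨m, hm⟩ := hd
  have hp0 : (0 : ℤ) < p := by exact_mod_cast hp.pos
  have hpos : 0 < 2 * x ^ 2 + 7 * y ^ 2 := by
    rcases hne with h | h <;> positivity
  have hm0 : 0 < m := by
    rw [hm] at hpos; exact (pos_iff_pos_of_mul_pos hpos).mp hp0
  have hm8 : m < 9 := by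
    by_contra! h
    nlinarith
  have hx7 := sq_emod_seven x
  interval_cases m
  · exact Or.inr ⟨x, y, by linarith⟩
  · rcases sq_emod_eight y with ⟨w, rfl, hw⟩ | hy2
    · exact Or.inl ⟨x, w, by linarith⟩
    · exfalso; omega
  · exfalso; omega
  · rcases sq_emod_eight y with ⟨w, rfl, hw⟩ | hy2
    · rcases sq_emod_eight x with ⟨z, rfl, hz⟩ | hx2
      · exact Or.inr ⟨z, w, by linarith⟩
      · exfalso; omega
    · exfalso; omega
  · exfalso; omega
  · exfalso; omega
  · obtain ⟨z, rfl⟩ : (7 : ℤ) ∣ x := by omega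
    exact Or.inl ⟨y, z, by linarith⟩
  · rcases sq_emod_eight y with ⟨w, rfl, hw⟩ | hy2
    · rcases sq_emod_eight x with ⟨z, rfl, hz⟩ | hx2
      · rcases sq_emod_eight w with ⟨v, rfl, hv⟩ | hw2
        · exact Or.inl ⟨z, v, by linarith⟩
        · exfalso; omega
      · exfalso; omega
    · exfalso; omega

/-! ### The criterion and the conclusion -/

theorem isRepresentedBy_fiftysix_or {p : ℕ} (hp : p.Prime) (hp8 : p % 8 = 1)
    (hp7 : p % 7 = 1 ∨ p % 7 = 2 ∨ p % 7 = 4) :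
    IsRepresentedBy 56 p ∨ ∃ x y : ℤ, (p : ℤ) = 2 * x ^ 2 + 7 * y ^ 2 := by
  refine (exists_eq_sq_add_fourteen_mul_sq_or hp hp8 hp7).imp_left fun ⟨x, y, h⟩ => ?_
  rcases sq_emod_eight y with ⟨w, rfl, hw⟩ | hy
  · exact ⟨x, w, by linarith⟩
  · rcases sq_emod_eight x with ⟨z, hz, hz'⟩ | hx <;> omega

/-- For a representation `p = a² + 112c²`, the parity of `c` and `p` modulo `16` decide whether `p`
is of the form `x² + 56y²`. -/
theorem isRepresentedBy_fiftysix_iff {p : ℕ} (hp : p.Prime) (hp8 : p % 8 = 1)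
    (hp7 : p % 7 = 1 ∨ p % 7 = 2 ∨ p % 7 = 4) {a c : ℤ} (h : (p : ℤ) = a ^ 2 + 112 * c ^ 2) :
    IsRepresentedBy 56 p ↔ (c % 2 = 1 ↔ p % 16 = 9) := by
  refine ⟨fun ⟨x, y, hxy⟩ => odd_iff_of_sq_add_fiftysix_mul_sq hp hp8 hxy h, fun hc => ?_⟩
  refine (isRepresentedBy_fiftysix_or hp hp8 hp7).resolve_right fun ⟨x, y, hxy⟩ => ?_
  have := odd_iff_of_two_mul_sq_add_seven_mul_sq hp hp8 hxy h
  omega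

theorem isRepresentedBy_fiftysix_iff_iff {p : ℕ} (hp : p.Prime) (hp8 : p % 8 = 1)
    (hp7 : p % 7 = 1 ∨ p % 7 = 2 ∨ p % 7 = 4) :
    (IsRepresentedBy 56 p ↔ IsRepresentedBy 448 p) ↔ p % 16 = 1 := by
  by_cases h448 : IsRepresentedBy 448 p
  · obtain ⟨x, y, hxy⟩ := id h448
    have key := isRepresentedBy_fiftysix_iff hp hp8 hp7 (a := x) (c := 2 * y) (by linarith)
    rw [iff_true_right h448, key]
    omega
  · obtain ⟨a, c, hac⟩ := exists_eq_sq_add_hundredtwelve_mul_sq hp hp8 hp7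
    have hc : c % 2 = 1 := by
      rcases sq_emod_eight c with ⟨d, rfl, hd⟩ | hc
      · exact absurd ⟨a, d, by linarith⟩ h448
      · exact hc.1
    rw [iff_false_right h448, isRepresentedBy_fiftysix_iff hp hp8 hp7 hac]
    omega

theorem mainTheorem2 (p : ℕ) (hp : p.Prime) :
    ((p ≡ 1 [MOD 112] ∨ p ≡ 65 [MOD 112] ∨ p ≡ 81 [MOD 112]) →
      (IsRepresentedBy 56 (p : ℤ) ↔ IsRepresentedBy 448 (p : ℤ))) ∧
    ((p ≡ 9 [MOD 112] ∨ p ≡ 25 [MOD 112] ∨ p ≡ 57 [MOD 112]) →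
      ((IsRepresentedBy 56 (p : ℤ) ∧ ¬ IsRepresentedBy 448 (p : ℤ)) ∨
        (IsRepresentedBy 448 (p : ℤ) ∧ ¬ IsRepresentedBy 56 (p : ℤ)))) := by
  simp only [Nat.ModEq]
  refine ⟨fun h => (isRepresentedBy_fiftysix_iff_iff hp (by omega) (by omega)).mpr (by omega),
    fun h => ?_⟩
  have := (isRepresentedBy_fiftysix_iff_iff hp (by omega) (by omega)).not.mpr (by omega)
  tauto
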